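/- Let $K_6^3$ be the hypergraph with vertex set $\{1,\dots,6\}$ whose hyperedges are all the $3$-element subsets of $\{1,\dots,6\}$. A homogeneous $2$-partition of $K_6^3$ is an ordered pair $\mathcal{P}=(\mathcal{H}_1,\mathcal{H}_2)$ of sub-hypergraphs of $K_6^3$, each with vertex set $\{1,\dots,6\}$, such that $E(\mathcal{H}_1)\cap E(\mathcal{H}_2)=\emptyset$, $E(\mathcal{H}_1)\cup E(\mathcal{H}_2)=E(K_6^3)$ and $|E(\mathcal{H}_1)|=|E(\mathcal{H}_2)|$. Let $\mathcal{P}_2^h(K_6^3)$ be the set of all of them. For $\mathcal{P}\in\mathcal{P}_2^h(K_6^3)$ and $1\leq x<y<z<t\leq 6$, let $Pair(\mathcal{P},(x,y,z,t))$ be the set of all $\mathcal{K}\in\mathcal{P}_2^h(K_6^3)$ that coincide with $\mathcal{P}$ except maybe on the hyperedges $\{x,y,z\}$, $\{x,y,t\}$, $\{x,z,t\}$ and $\{y,z,t\}$. Let $\mathcal{P}^{(1)}=(\mathcal{H}^{(1)}_1,\mathcal{H}^{(1)}_2)\in\mathcal{P}_2^h(K_6^3)$ be given by $$E(\mathcal{H}^{(1)}_1)=\{\{1,2,3\},\{1,2,4\},\{1,3,4\},\{1,2,5\},\{3,4,5\},\{1,5,6\},\{2,4,6\},\{2,5,6\},\{3,4,6\},\{4,5,6\}\},$$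 $$E(\mathcal{H}^{(1)}_2)=\{\{1,2,6\},\{1,3,5\},\{1,3,6\},\{1,4,5\},\{1,4,6\},\{2,3,4\},\{2,3,5\},\{2,3,6\},\{2,4,5\},\{3,5,6\}\}.$$ There exists a unique map $\varepsilon^{S^3}:\mathcal{P}_2^h(K_6^3)\to\{-4,-1,0,1\}$ such that (i) if $\mathcal{P}\in\mathcal{P}_2^h(K_6^3)$ and $1\leq x<y<z<t\leq 6$, then $$\sum_{\mathcal{K}\in Pair(\mathcal{P},(x,y,z,t))}\varepsilon^{S^3}(\mathcal{K})=0,$$ (ii) $\varepsilon^{S^3}(\mathcal{P}^{(1)})=1$. -/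

import Mathlib

/-- The complete `r`-uniform hypergraph `K_n^r`: its vertices are `1, …, n`, and its hyperedges are
all the subsets of size `r` of `{1, …, n}`. -/
def completeUniform (n r : ℕ) : Hypergraph ℕ where
  vertexSet := Set.Icc 1 n
  edgeSet := {e | e ⊆ Set.Icc 1 n ∧ e.encard = r}
  subset_vertexSet_of_mem_edgeSet' := fun _ he => he.1

/-- A `k`-partition of a hypergraph `H`: an ordered collection of `k` sub-hypergraphs of `H`, each
with the same vertices as `H`, whose sets of hyperedges are pairwise disjoint and have union the
set of hyperedges of `H`. (The last condition contains that the parts are sub-hypergraphs.) -/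
@[ext]
structure HypergraphPartition {α : Type*} (H : Hypergraph α) (k : ℕ) where
  /-- The parts `H_1, …, H_k`, indexed here by `0, …, k - 1`. -/
  part : Fin k → Hypergraph α
  vertexSet_part : ∀ i, (part i).vertexSet = H.vertexSet
  disjoint_part : ∀ i j, i ≠ j → Disjoint (part i).edgeSet (part j).edgeSet
  iUnion_part : ⋃ i, (part i).edgeSet = H.edgeSet

/-- A partition is homogeneous if all its parts have the same number of hyperedges. -/
def HypergraphPartition.IsHomogeneous {α : Type*} {H : Hypergraph α} {k : ℕ}
    (P : HypergraphPartition H k) : Prop :=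
  ∀ i j, (P.part i).edgeSet.encard = (P.part j).edgeSet.encard

/-- The set of homogeneous `2`-partitions of `K_6^3`, as a type. -/
abbrev HomPartition : Type :=
  {P : HypergraphPartition (completeUniform 6 3) 2 // P.IsHomogeneous}

theorem completeUniform_edgeSet_finite (n r : ℕ) : (completeUniform n r).edgeSet.Finite :=
  (Set.finite_Icc 1 n).finite_subsets.subset fun _ he => he.1

theorem HypergraphPartition.finite {α : Type*} {H : Hypergraph α} (k : ℕ)
    (hH : H.edgeSet.Finite) : Finite (HypergraphPartition H k) := by
  have : Finite H.edgeSet.powerset := hH.finite_subsets.to_subtype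
  refine Finite.of_injective (β := Fin k → H.edgeSet.powerset)
    (fun P i => ⟨(P.part i).edgeSet, ?_⟩) ?_
  · intro e he
    rw [← P.iUnion_part]
    exact Set.mem_iUnion.2 ⟨i, he⟩
  · intro P Q h
    ext1
    funext i
    refine Hypergraph.ext ((P.vertexSet_part i).trans (Q.vertexSet_part i).symm) ?_
    exact congrArg Subtype.val (congrFun h i)

noncomputable instance : Fintype HomPartition :=
  have := HypergraphPartition.finite 2 (completeUniform_edgeSet_finite 6 3)
  Fintype.ofFinite _

/-- The four hyperedges `{x,y,z}`, `{x,y,t}`, `{x,z,t}`, `{y,z,t}`. -/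
def tetraFaces (x y z t : ℕ) : Set (Set ℕ) :=
  {{x, y, z}, {x, y, t}, {x, z, t}, {y, z, t}}

open Classical in
/-- `Pair(P, (x,y,z,t))`: the set of all homogeneous `2`-partitions of `K_6^3` that coincide with
`P` except maybe on the hyperedges `{x,y,z}`, `{x,y,t}`, `{x,z,t}` and `{y,z,t}`. -/
noncomputable def pair (P : HomPartition) (x y z t : ℕ) : Finset HomPartition :=
  Finset.univ.filter fun K => ∀ e ∈ (completeUniform 6 3).edgeSet, e ∉ tetraFaces x y z t →
    ∀ i, e ∈ (K.1.part i).edgeSet ↔ e ∈ (P.1.part i).edgeSet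

/-- The hyperedges of the two parts of `P^(1)`, as finite sets. -/
def partitionOneEdges : Fin 2 → Finset (Finset ℕ) :=
  ![{{1, 2, 3}, {1, 2, 4}, {1, 3, 4}, {1, 2, 5}, {3, 4, 5},
      {1, 5, 6}, {2, 4, 6}, {2, 5, 6}, {3, 4, 6}, {4, 5, 6}},
    {{1, 2, 6}, {1, 3, 5}, {1, 3, 6}, {1, 4, 5}, {1, 4, 6},
      {2, 3, 4}, {2, 3, 5}, {2, 3, 6}, {2, 4, 5}, {3, 5, 6}}]

theorem partitionOneEdges_union :
    partitionOneEdges 0 ∪ partitionOneEdges 1 = Finset.powersetCard 3 (Finset.Icc 1 6) := by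
  decide +kernel

theorem partitionOneEdges_card (i : Fin 2) : (partitionOneEdges i).card = 10 := by
  revert i
  decide +kernel

theorem partitionOneEdges_disjoint (i j : Fin 2) (h : i ≠ j) :
    Disjoint (partitionOneEdges i) (partitionOneEdges j) := by
  revert i j
  decide +kernel

theorem partitionOneEdges_subset (i : Fin 2) :
    ∀ f ∈ partitionOneEdges i, f ⊆ Finset.Icc 1 6 := by
  revert i
  decide +kernel

/-- The `2`-partition `P^(1)` of `K_6^3`. -/
def partitionOne : HypergraphPartition (completeUniform 6 3) 2 where
  part i :=
    { vertexSet := Set.Icc 1 6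
      edgeSet := (fun f : Finset ℕ => (f : Set ℕ)) '' (partitionOneEdges i)
      subset_vertexSet_of_mem_edgeSet' := by
        rintro _ ⟨f, hf, rfl⟩
        have := partitionOneEdges_subset i f hf
        rw [← Finset.coe_subset] at this
        simpa using this }
  vertexSet_part _ := rfl
  disjoint_part i j h :=
    (Set.disjoint_image_iff Finset.coe_injective).2
      (Finset.disjoint_coe.2 (partitionOneEdges_disjoint i j h))
  iUnion_part := by
    have key : ∀ f : Finset ℕ, (∃ i, f ∈ partitionOneEdges i) ↔
        f ⊆ Finset.Icc 1 6 ∧ f.card = 3 := by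
      intro f
      rw [← Finset.mem_powersetCard, ← partitionOneEdges_union, Finset.mem_union,
        Fin.exists_fin_two]
    ext e
    simp only [Set.mem_iUnion, Set.mem_image, Finset.mem_coe]
    constructor
    · rintro ⟨i, f, hf, rfl⟩
      obtain ⟨h1, h2⟩ := (key f).1 ⟨i, hf⟩
      refine ⟨?_, by simp [Set.encard_coe_eq_coe_finsetCard, h2]⟩
      rw [← Finset.coe_subset] at h1
      simpa using h1
    · rintro ⟨h1, h2⟩
      obtain ⟨f, rfl⟩ := ((Set.finite_Icc 1 6).subset h1).exists_finset_coe
      have h3 : f ⊆ Finset.Icc 1 6 := by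
        rw [← Finset.coe_subset]
        simpa using h1
      rw [Set.encard_coe_eq_coe_finsetCard] at h2
      obtain ⟨i, hi⟩ := (key f).2 ⟨h3, by exact_mod_cast h2⟩
      exact ⟨i, f, hi, rfl⟩

theorem partitionOne_isHomogeneous : partitionOne.IsHomogeneous := by
  have key : ∀ i, (partitionOne.part i).edgeSet.encard = 10 := fun i => by
    change ((fun f : Finset ℕ => (f : Set ℕ)) '' (partitionOneEdges i)).encard = 10
    rw [Finset.coe_injective.encard_image, Set.encard_coe_eq_coe_finsetCard,
      partitionOneEdges_card]
    rfl
  exact fun i j => (key i).trans (key j).symm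

/-! Partitions are encoded by masks of twenty bits, one for each triple. The solutions of the linear
system are determined by their value at `P^(1)`, by a verified computation up to permutations of
the vertices; a nonzero solution is the determinant of the boundary vectors of the triples,
tensored with the first or the second basis vector of the plane. -/

/-! A homogeneous partition is a set of ten of the twenty triples. Condition (i) says: fix the first
part off the faces of a tetrahedron, and the number of faces in it; the values then sum to zero.

Uniqueness: a tetrahedron with its four faces in one part gives a relation with a single term, so
the value there is zero. The symmetric group permutes the relations, and chains of relations with an
even number of sign changes show that each adjacent transposition preserves the value at `P^(1)`
(`IsSolution.act_baseMask`). The multiple of that value forced at a partition is therefore constant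
on orbits (`Forced.act`), and only masks that no adjacent transposition decreases need treatment.
`checkTable_table` derives their multiples one relation at a time, and `covers_table` shows by a
pruned search that none is missing. This gives `exists_forced`.

Existence: a cycle of the complete graph on six vertices is determined by its coefficients on the
ten edges avoiding 6. The boundary of each triple, tensored with the basis vector of the plane
attached to its part, gives twenty vectors in dimension twenty; their determinant is the solution.
If the four faces of a tetrahedron all carry the plane vector `(x, 1)`, the rows are dependent,
because a boundary has no boundary. The determinant is then the zero polynomial in `x`, and its
coefficients are the relations (`sum_det_rows`). As it is nonzero at `P^(1)`, the forced multiples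
satisfy the relations too (`exists_setSolution`). -/

namespace TripleMask

/-! ### Masks, relations and the certificates of the computation. -/

/-- The fifteen tetrahedra of `K_6^3`, each given by the bits of its four faces. The twenty triples
are numbered from `0` to `19` in reverse colexicographic order. -/
def tetras : List (ℕ × ℕ × ℕ × ℕ) :=
  [(65536, 131072, 262144, 524288), (8192, 16384, 32768, 524288), (2048, 4096, 32768, 262144),
   (1024, 4096, 16384, 131072), (1024, 2048, 8192, 65536), (128, 256, 512, 524288),
   (32, 64, 512, 262144), (16, 64, 256, 131072), (16, 32, 128, 65536),
   (4, 8, 512, 32768), (2, 8, 256, 16384), (2, 4, 128, 8192),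
   (1, 8, 64, 4096), (1, 4, 32, 2048), (1, 2, 16, 1024)]

/-- The action on triples of the five adjacent transpositions of `{1, …, 6}`: a mask of the fixed
triples, and masks of the triples to be exchanged with the one some places further. -/
def swaps : List (ℕ × List (ℕ × ℕ)) :=
  [(820755, [(1, 75940)]), (602313, [(1, 148754)]), (230940, [(1, 262145), (2, 6240)]),
   (532353, [(3, 57358)]), (983055, [(6, 1008)])]

/-- The mask of the first part of `P^(1)`. -/
abbrev baseMask : ℕ := 951357

/-- The union of the four faces of a tetrahedron. -/
def faces (t : ℕ × ℕ × ℕ × ℕ) : ℕ := Nat.add (Nat.add t.1 t.2.1) (Nat.add t.2.2.1 t.2.2.2)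

/-- The unions of `j` faces of a tetrahedron. -/
def faceUnions : ℕ → ℕ × ℕ × ℕ × ℕ → List ℕ
  | 0, _ => [0]
  | 1, (a, b, c, d) => [a, b, c, d]
  | 2, (a, b, c, d) =>
    [Nat.add a b, Nat.add a c, Nat.add a d, Nat.add b c, Nat.add b d, Nat.add c d]
  | 3, (a, b, c, d) =>
    [Nat.add a (Nat.add b c), Nat.add a (Nat.add b d), Nat.add a (Nat.add c d),
      Nat.add b (Nat.add c d)]
  | 4, (a, b, c, d) => [Nat.add (Nat.add a b) (Nat.add c d)]
  | _, _ => []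

/-- The number of faces of a tetrahedron in a mask. -/
def level (m : ℕ) (t : ℕ × ℕ × ℕ × ℕ) : ℕ :=
  Nat.add (Nat.add (Nat.div (Nat.land m t.1) t.1) (Nat.div (Nat.land m t.2.1) t.2.1))
    (Nat.add (Nat.div (Nat.land m t.2.2.1) t.2.2.1) (Nat.div (Nat.land m t.2.2.2) t.2.2.2))

/-- The masks with as many faces of `t` as `m` which agree with `m` off the faces of `t`. -/
def family (m : ℕ) (t : ℕ × ℕ × ℕ × ℕ) : List ℕ :=
  (faceUnions (level m t) t).map fun x => Nat.lor (Nat.xor m (Nat.land m (faces t))) x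

/-- The image of a mask by one of the `swaps`. -/
def act (l : ℕ × List (ℕ × ℕ)) (m : ℕ) : ℕ :=
  l.2.foldl (fun acc p => Nat.lor acc (Nat.lor (Nat.shiftLeft (Nat.land m p.2) p.1)
    (Nat.land (Nat.shiftRight m p.1) p.2))) (Nat.land m l.1)

/-- Membership of a natural number in a list, in a form suited to evaluation. -/
def elem (k : ℕ) (L : List ℕ) : Bool := L.any (Nat.beq k)

/-- The first entry of a list of triples with a given key. -/
def entry (k : ℕ) : List (ℕ × ℤ × ℕ) → Option ℤ
  | [] => none
  | e :: es => bif Nat.beq k e.1 then some e.2.1 else entry k es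

/-- Removal of the first occurrence of a natural number from a list. -/
def without (k : ℕ) : List ℕ → List ℕ
  | [] => []
  | x :: xs => bif Nat.beq k x then xs else x :: without k xs

/-- Functions of masks satisfying the relations of all tetrahedra. -/
structure IsSolution (F : ℕ → ℤ) : Prop where
  mod_eq : ∀ m, F (m % 2 ^ 20) = F m
  sum_eq_zero : ∀ t ∈ tetras, ∀ j < 5, ∀ m, m &&& faces t = 0 →
    ((faceUnions j t).map fun x => F (m ||| x)).sum = 0

/-- All solutions have at `m` the multiple by `v` of their value at `baseMask`. -/
def Forced (m : ℕ) (v : ℤ) : Prop := ∀ F, IsSolution F → F m = v * F baseMask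

/-- The union of the four faces of each tetrahedron, sorted by the lowest bit. -/
def faceMasks : List (List ℕ) :=
  [[4169, 2085, 1043], [16650, 8326], [33292], [], [131408, 65712], [262752], [], [525184], [], [],
   [152576, 76800], [301056], [], [581632], [], [], [983040]]

/-- A face mask all of whose bits in `m` are equal. -/
def constantOn (m f : ℕ) : Bool := Nat.beq (Nat.land m f) 0 || Nat.beq (Nat.land m f) f

/-- Some tetrahedron of `K_6^3` has its four faces all in the mask or all outside. -/
def isMono (m : ℕ) : Bool :=
  faceMasks.any fun L => L.any (constantOn m)

/-- Some relation has `m` as only term which is not trivially zero. -/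
def isZero (m : ℕ) : Bool :=
  tetras.any fun t => elem m (family m t) && (without m (family m t)).all isMono

/-- Moves from a mask to another whose value is opposite. -/
def path : ℕ → List (ℕ × ℕ) → ℕ → Bool
  | m, [], e => Nat.beq m e
  | m, (t, k) :: p, e =>
    match tetras[t]? with
    | none => false
    | some t => elem m (family m t) && elem k (without m (family m t)) &&
        (without k (without m (family m t))).all (fun x => isMono x || isZero x) && path k p e

/-- Greedy descent by adjacent transpositions. -/
def descend : ℕ → ℕ → ℕ
  | 0, m => m
  | n + 1, m =>
    match swaps.find? fun l => Nat.blt (act l m) m with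
    | none => m
    | some l => descend n (act l m)

/-- The value at `m` according to a table of known values. -/
def value (T : List (ℕ × ℤ × ℕ)) (m : ℕ) : Option ℤ :=
  bif isMono m then some 0 else entry (descend 40 m) T

/-- The sum of the values at the entries of a list. -/
def sumValues (T : List (ℕ × ℤ × ℕ)) : List ℕ → Option ℤ
  | [] => some 0
  | k :: ks =>
    match value T k, sumValues T ks with
    | some a, some b => some (a + b)
    | _, _ => none

/-- Each entry `(m, v, t)` follows from the relation of the tetrahedron `t` and earlier entries. -/
def checkTable : List (ℕ × ℤ × ℕ) → List (ℕ × ℤ × ℕ) → Bool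
  | _, [] => true
  | T, (m, v, t) :: es =>
    (match tetras[t]? with
      | none => false
      | some t => elem m (family m t) &&
          sumValues T (without m (family m t)) == some (-v)) &&
      checkTable ((m, v, t) :: T) es

/-- The value at `m` is in the table, or an adjacent transposition decreases `m`. -/
def decided (T : List (ℕ × ℤ × ℕ)) (m : ℕ) : Bool :=
  (swaps.any fun l => Nat.blt (act l m) m) || (entry m T).isSome

/-- An adjacent transposition decreases the bits of `m` from the `n`-th on. -/
def descends (n : ℕ) (l : ℕ × List (ℕ × ℕ)) (m : ℕ) : Bool :=
  Nat.blt (Nat.shiftRight (act l m) n) (Nat.shiftRight m n)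

/-- The bits of `m` from the `n`-th on show a monochromatic tetrahedron, or that an adjacent
transposition decreases `m`. -/
def pruned (n m : ℕ) : Bool :=
  (faceMasks.getD n []).any (constantOn m) ||
  (Nat.beq n 16 && (swaps.take 3).any fun l => descends n l m) ||
  (Nat.beq n 10 && (swaps.take 4).any fun l => descends n l m)

/-- All the masks obtained from `m` by adding `k` bits below the `n`-th are decided. -/
def covers (T : List (ℕ × ℤ × ℕ)) : ℕ → ℕ → ℕ → Bool
  | 0, k, m => pruned 0 m || Nat.blt 0 k || decided T m
  | n + 1, k, m => pruned (n + 1) m ||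
      (covers T n k m && (Nat.beq k 0 || covers T n (Nat.pred k) (Nat.add m (Nat.pow 2 n))))

/-- Local minima of the descent, with the value of the solution and the relation giving it. -/
def table : List (ℕ × ℤ × ℕ) :=
  [(78143, 0, 2), (78206, 0, 2), (78623, 0, 2), (78647, 0, 2), (78651, 0, 2),
   (78654, 0, 0), (78686, 0, 2), (78747, 0, 0), (78749, 0, 0), (78812, 0, 0),
   (79151, 0, 4), (79165, 0, 4), (79166, 0, 8), (79198, 0, 3), (79214, 0, 8),
   (79275, 0, 8), (79277, 0, 4), (79324, 0, 11), (79340, 0, 3), (79421, 0, 4),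
   (79422, 0, 4), (79454, 0, 4), (79470, 0, 2), (79517, 0, 2), (79580, 0, 2),
   (79596, 0, 2), (79631, 0, 0), (79655, 0, 2), (79661, 0, 4), (79670, 0, 2),
   (79673, 0, 1), (79694, 0, 0), (79708, 0, 11), (79724, 0, 2), (79765, 0, 2),
   (79781, 0, 2), (79788, 0, 2), (79820, 0, 2), (86391, 0, 0), (86503, 0, 0),
   (86591, 0, 0), (86647, 0, 0), (86654, 0, 0), (86743, 0, 0), (86750, 0, 0),
   (86759, 0, 0), (86766, 0, 0), (86871, 0, 0), (86887, 0, 0), (86899, 0, 0),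
   (86901, 0, 0), (86902, 0, 0), (86908, 0, 0), (87011, 0, 0), (87013, 0, 0),
   (87399, 0, 3), (87413, 0, 3), (87414, 0, 3), (87420, 0, 3), (87525, 0, 3),
   (87532, 0, 3), (87646, 0, 0), (87669, 0, 1), (87674, 0, 3), (87676, -1, 9),
   (87765, 0, 1), (87779, 0, 3), (87781, 0, 1), (87782, 0, 3), (87786, 0, 0),
   (87788, 0, 0), (87879, 0, 0), (87893, 0, 0), (87900, 0, 0), (87907, 0, 0),
   (87909, 1, 0), (87910, -1, 8), (87916, 0, 0), (87922, 0, 3), (87924, 0, 3),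
   (88033, 0, 0), (88036, 0, 0), (88040, 0, 0), (88438, 0, 3), (88444, 0, 3),
   (88519, 0, 0), (88533, 0, 3), (88534, 0, 3), (88540, 0, 3), (88550, 0, 3),
   (88607, 0, 5), (88686, 0, 0), (88691, 0, 3), (88700, 0, 2), (88727, 0, 4),
   (88733, 0, 6), (88789, 0, 1), (88794, 0, 0), (88796, 0, 8), (88806, 0, 0),
   (88886, 0, 3), (88903, 0, 0), (88915, 0, 0), (88917, -1, 9), (88918, 1, 4),
   (88924, 0, 0), (88931, 0, 0), (88934, 0, 0), (88946, -1, 9), (88948, 1, 0),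
   (88967, 1, 3), (88973, -1, 9), (88979, 0, 0), (88981, 0, 1), (88982, 0, 0),
   (88988, 1, 4), (88998, 0, 0), (89001, 1, 13), (89027, 0, 0), (89029, 1, 4),
   (89030, -1, 1), (89041, 1, 4), (89042, 0, 0), (89044, -1, 4), (89048, 0, 0),
   (89057, -1, 8), (89058, 1, 4), (89460, 0, 3), (89510, 0, 4), (89513, 0, 3),
   (89516, 0, 4), (89541, 0, 3), (89542, 0, 4), (89548, 0, 4), (89556, 0, 3),
   (89560, 0, 3), (89572, 0, 3), (89576, 0, 3), (89629, 0, 0), (89630, 0, 0),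
   (89654, 0, 0), (89658, 1, 0), (89660, -1, 0), (89671, 0, 0), (89678, 0, 0),
   (89685, 0, 0), (89686, -1, 0), (89690, 0, 0), (89692, 1, 0), (89699, 0, 0),
   (89702, 1, 0), (89706, -1, 0), (89708, 0, 0), (89714, 0, 5), (89716, 0, 1),
   (89749, 0, 1), (89750, 0, 1), (89753, 0, 5), (89754, -1, 8), (89756, 1, 8),
   (89795, 0, 0), (89797, 0, 0), (89798, 0, 4), (89802, 1, 0), (89804, -1, 8),
   (89809, 0, 1), (89810, 1, 12), (89812, 0, 1), (89816, -1, 11), (89825, 0, 1),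
   (89826, -1, 8), (89828, 0, 1), (89832, 1, 3), (89863, 0, 0), (89869, 0, 0),
   (89877, 0, 0), (89878, 1, 9), (89884, -1, 5), (89891, 0, 0), (89894, -1, 7),
   (89900, 1, 4), (89906, -1, 7), (89908, 1, 10), (89923, 0, 0), (89925, 0, 0),
   (89926, 0, 0), (89932, 0, 0), (89938, 0, 3), (89940, 0, 3), (89956, -1, 0),
   (89987, 0, 5), (89989, 0, 1), (89990, 0, 4), (89993, 0, 0), (89996, 0, 0),
   (90001, 0, 5), (90002, 0, 2), (90004, -1, 10), (90008, 1, 5), (90017, 0, 1),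
   (90018, 1, 1), (90020, 0, 1), (90024, -1, 0), (90049, 0, 0), (90050, -1, 0),
   (90052, 1, 0), (90056, 0, 0), (90064, 0, 3), (90080, 0, 0), (96791, 0, 4),
   (96795, 0, 1), (96797, 0, 1), (96819, 0, 4), (96822, 0, 2), (96825, 1, 2),
   (96826, -1, 2), (96828, 0, 2), (96839, 0, 0), (96846, 0, 0), (96851, 0, 4),
   (96853, -1, 4), (96854, 1, 4), (96858, 0, 0), (96860, 0, 0), (96867, 0, 2),
   (96870, -1, 2), (96874, 1, 0), (96881, 0, 1), (96882, 0, 2), (96884, 1, 2),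
   (96888, -1, 2), (96963, 0, 3), (96965, 1, 2), (96970, -1, 0), (96977, 1, 3),
   (96978, -1, 3), (96980, -1, 3), (96984, 1, 0), (96993, -1, 2), (96994, 1, 2),
   (97091, 0, 0), (97093, 0, 0), (97105, 0, 0), (97108, 0, 0), (97112, 0, 0),
   (97121, 1, 0), (97122, -1, 0), (97136, 0, 3), (119623, 0, 0), (119635, 0, 0),
   (119637, 0, 0), (119666, 0, 0), (120660, 0, 0), (120674, 0, 0), (120676, 0, 0),
   (120800, 0, 0), (122753, 0, 0), (122754, 0, 0), (122760, 0, 0), (122768, 0, 0),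
   (122816, 0, 0), (227847, 0, 0), (227853, 0, 0), (227859, 0, 3), (227861, 0, 3),
   (227868, 0, 0), (227878, 0, 3), (227881, 0, 3), (227882, 0, 3), (227896, 0, 3),
   (230007, 0, 0), (230103, 0, 0), (230107, 0, 0), (230119, 0, 0), (230123, 0, 0),
   (230371, 0, 0), (230373, 0, 0), (231015, 0, 1), (231030, 0, 1), (231079, 0, 0),
   (231083, 0, 0), (231111, 0, 1), (231115, 0, 1), (231126, 0, 1), (231129, 0, 1),
   (231139, 0, 0), (231142, 0, 0), (231145, 0, 1), (231146, 0, 1), (231393, 0, 0),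
   (231396, 0, 0), (231995, 0, 3), (232023, 1, 0), (232027, -1, 0), (232043, 0, 2),
   (232051, 0, 1), (232054, -1, 6), (232058, 1, 2), (232087, 0, 1), (232091, 0, 3),
   (232107, 0, 1), (232135, -1, 0), (232139, 1, 0), (232147, -1, 6), (232150, 1, 1),
   (232153, 0, 0), (232154, 0, 0), (232163, 1, 6), (232166, 0, 1), (232169, 0, 2),
   (232170, -1, 0), (232215, -1, 0), (232219, 1, 0), (232235, 0, 0), (232243, 1, 2),
   (232250, -1, 0), (232263, 0, 0), (232267, 0, 0), (232291, -1, 0), (232294, 1, 0),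
   (232298, 0, 0), (232327, 1, 1), (232331, -1, 2), (232339, 0, 0), (232341, 0, 0),
   (232345, 0, 0), (232346, 0, 0), (232355, -1, 4), (232361, 0, 0), (232362, 1, 3),
   (232387, 1, 2), (232389, 0, 0), (232390, -1, 1), (232393, 0, 0), (232394, 0, 0),
   (232417, 0, 0), (232418, 0, 0), (233018, 0, 1), (233031, -1, 0), (233035, 1, 0),
   (233046, 0, 1), (233050, 0, 1), (233059, 0, 1), (233062, 1, 1), (233066, -1, 1),
   (233074, 0, 1), (233095, 0, 1), (233099, 0, 1), (233113, 0, 0), (233114, 0, 0),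
   (233123, 0, 1), (233129, 0, 1), (233130, 0, 1), (233155, 1, 0), (233158, 0, 0),
   (233161, -1, 0), (233162, 0, 0), (233170, 0, 1), (233176, 0, 0), (233186, -1, 1),
   (233192, 1, 1), (233223, 1, 0), (233227, -1, 0), (233237, 0, 1), (233242, 0, 1),
   (233251, -1, 1), (233258, 1, 0), (233283, 0, 0), (233285, 1, 0), (233286, -1, 0),
   (233290, 0, 0), (233314, 1, 1), (233316, -1, 1), (233347, 0, 0), (233349, -1, 0),
   (233353, 1, 0), (233354, 0, 0), (233361, 0, 0), (233368, 0, 0), (233377, 1, 0),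
   (233384, -1, 0), (233409, -1, 0), (233410, 0, 0), (233412, 1, 0), (233416, 0, 0),
   (233440, 0, 0), (236131, 0, 2), (236134, 0, 2), (236146, 0, 1), (236167, 1, 2),
   (236171, -1, 2), (236179, 0, 0), (236182, -1, 0), (236185, 0, 0), (236186, 1, 0),
   (236195, -1, 1), (236198, 0, 2), (236201, 0, 2), (236202, 1, 0), (236227, 1, 0),
   (236230, 0, 0), (236234, -1, 0), (236242, 0, 1), (236248, 0, 1), (236258, 0, 1),
   (236419, 0, 0), (236421, 0, 0), (236422, 0, 0), (236433, 0, 0), (236434, 0, 0),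
   (236436, 0, 0), (236449, 0, 0), (236450, 0, 0), (237187, 0, 0), (237190, 0, 0),
   (237193, 0, 0), (237194, 0, 0), (237202, 0, 0), (237208, 0, 0), (237218, 1, 1),
   (237224, -1, 5), (237250, -1, 0), (237256, 1, 0), (237441, 0, 0), (237442, 0, 0),
   (237444, 0, 0), (237456, 0, 0), (237472, 0, 0), (240291, 0, 3), (240297, 0, 3),
   (240323, 1, 0), (240329, -1, 0), (240330, 0, 0), (240338, -1, 2), (240344, 1, 0),
   (240354, 0, 3), (240451, 0, 0), (240453, 0, 0), (240457, 0, 0), (240481, 1, 0),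
   (240482, -1, 0), (242371, 0, 0), (242402, 0, 0), (242439, 1, 0), (242443, -1, 0),
   (242451, 1, 0), (242453, 0, 0), (242454, -1, 0), (242457, 0, 0), (242467, -4, 0),
   (242469, 1, 0), (242470, 1, 0), (242473, 1, 0), (242474, 1, 0), (242481, 1, 0),
   (242482, 1, 0), (242484, -1, 0), (242488, -1, 0), (242499, 1, 0), (242501, 0, 0),
   (242502, -1, 0), (242529, -1, 0), (242530, 1, 0), (242563, 1, 0), (242565, -1, 0),
   (242569, 0, 0), (242577, -1, 0), (242580, 1, 0), (242593, 1, 0), (242594, -1, 0),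
   (242625, 0, 0), (243459, -1, 2), (243461, 0, 0), (243462, 0, 0), (243465, 1, 3),
   (243473, 0, 1), (243476, 0, 0), (243489, 1, 0), (243490, 1, 0), (243492, -1, 0),
   (243496, -1, 0), (243504, 0, 1), (243521, -1, 2), (243524, 1, 0), (243552, 0, 1),
   (243585, 0, 1), (243588, 0, 1), (243616, 0, 1), (244483, 1, 1), (244485, 0, 0),
   (244486, 0, 0), (244489, -1, 2), (244490, 0, 0), (244497, 0, 0), (244498, -1, 0),
   (244500, 0, 0), (244504, 1, 0), (244513, -1, 0), (244514, 1, 0), (244528, 0, 1),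
   (244545, 1, 0), (244546, -1, 0), (244609, 0, 0), (244610, 0, 0), (244624, 0, 0),
   (516993, 0, 0), (79645, 1, 1), (79646, -1, 1), (79659, -1, 3), (79662, 1, 1),
   (79674, 1, 3), (79676, -1, 2), (79755, 1, 0), (79757, -1, 0), (79769, -1, 0),
   (79772, 1, 0), (79785, 1, 0), (79786, -1, 0), (87613, 1, 1), (87614, -1, 1),
   (87655, -1, 1), (87662, 1, 0), (87670, 1, 0), (87751, 1, 0), (87758, -1, 0),
   (87766, -1, 1), (87772, 1, 0), (88635, -1, 1), (88638, 1, 1), (88663, 1, 1),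
   (88670, -1, 0), (88694, -1, 0), (88698, 1, 0), (88731, 1, 0), (88734, -1, 0),
   (88775, -1, 0), (88782, 1, 0), (88787, -1, 0), (88790, 1, 1), (88803, 1, 0),
   (88810, -1, 0), (88855, -1, 0), (88861, 1, 0), (88883, 1, 1), (88892, -1, 0),
   (88985, -1, 0), (88995, -1, 0)]

/-- For each adjacent transposition, moves from `baseMask` to its image. -/
def swapPaths : List (List (ℕ × ℕ)) :=
  [[(0, 885821), (6, 885853)],
   [(1, 934973), (4, 942141), (11, 942139), (4, 935995)],
   [(8, 951453), (14, 951454)],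
   [(1, 934973), (7, 804205), (9, 836965), (10, 836711)],
   [(9, 919101), (13, 921117)]]

set_option maxRecDepth 100000

theorem swapPaths_spec :
    (swaps.zip swapPaths).all (fun p => path baseMask p.2 (act p.1 baseMask)) = true := by
  decide +kernel

theorem checkTable_table : checkTable [(89954, 1, 0)] table = true := by
  decide +kernel

theorem covers_table : covers (table ++ [(89954, 1, 0)]) 20 10 0 = true := by
  decide +kernel

/-! ### Action of the adjacent transpositions on masks and relations. -/

theorem testBit_land (m n i : ℕ) : (Nat.land m n).testBit i = (m.testBit i && n.testBit i) :=
  Nat.testBit_and m n i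

theorem testBit_lor (m n i : ℕ) : (Nat.lor m n).testBit i = (m.testBit i || n.testBit i) :=
  Nat.testBit_or m n i

theorem testBit_xor (m n i : ℕ) :
    (Nat.xor m n).testBit i = (m.testBit i ^^ n.testBit i) :=
  Nat.testBit_xor m n i

/-- The permutation of the triples underlying one of the `swaps`. -/
def swapIndex (l : ℕ × List (ℕ × ℕ)) (i : ℕ) : ℕ :=
  l.2.foldr (fun p acc => if p.2.testBit i then i + p.1 else
    if p.1 ≤ i ∧ p.2.testBit (i - p.1) then i - p.1 else acc) i

/-- One formula for all five transpositions, from which the bound and the compatibility with unions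
follow uniformly. -/
theorem act_eq {l : ℕ × List (ℕ × ℕ)} (hl : l ∈ swaps) :
    ∃ k s a s' a', k < 2 ^ 20 ∧ a < 2 ^ 20 ∧ a <<< s < 2 ^ 20 ∧ a' < 2 ^ 20 ∧
      a' <<< s' < 2 ^ 20 ∧
      ∀ m, act l m = (m &&& k ||| ((m &&& a) <<< s ||| m >>> s &&& a)) |||
        ((m &&& a') <<< s' ||| m >>> s' &&& a') := by
  simp only [swaps, List.mem_cons, List.not_mem_nil, or_false] at hl
  rcases hl with rfl | rfl | rfl | rfl | rfl
  -- Only the third transposition needs two shifts; for the others the second exchange is empty.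
  · refine ⟨820755, 1, 75940, 0, 0, by decide, by decide, by decide, by decide, by decide, ?_⟩
    intro m; simp [act]
  · refine ⟨602313, 1, 148754, 0, 0, by decide, by decide, by decide, by decide, by decide, ?_⟩
    intro m; simp [act]
  · refine ⟨230940, 1, 262145, 2, 6240, by decide, by decide, by decide, by decide, by decide, ?_⟩
    intro m; rfl
  · refine ⟨532353, 3, 57358, 0, 0, by decide, by decide, by decide, by decide, by decide, ?_⟩
    intro m; simp [act]
  · refine ⟨983055, 6, 1008, 0, 0, by decide, by decide, by decide, by decide, by decide, ?_⟩
    intro m; simp [act]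

theorem act_lt {l : ℕ × List (ℕ × ℕ)} (hl : l ∈ swaps) (m : ℕ) : act l m < 2 ^ 20 := by
  obtain ⟨k, s, a, s', a', hk, ha, hs, ha', hs', h⟩ := act_eq hl
  rw [h, Nat.shiftLeft_and_distrib, Nat.shiftLeft_and_distrib]
  refine Nat.or_lt_two_pow (Nat.or_lt_two_pow (Nat.and_lt_two_pow _ hk)
    (Nat.or_lt_two_pow (Nat.and_lt_two_pow _ hs) (Nat.and_lt_two_pow _ ha)))
    (Nat.or_lt_two_pow (Nat.and_lt_two_pow _ hs') (Nat.and_lt_two_pow _ ha'))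

theorem act_lor {l : ℕ × List (ℕ × ℕ)} (hl : l ∈ swaps) (m x : ℕ) :
    act l (Nat.lor m x) = Nat.lor (act l m) (act l x) := by
  obtain ⟨k, s, a, s', a', -, -, -, -, -, h⟩ := act_eq hl
  refine Nat.eq_of_testBit_eq fun i => ?_
  rw [testBit_lor, h, h, h]
  simp only [Nat.testBit_or, Nat.testBit_and, Nat.testBit_shiftLeft, Nat.testBit_shiftRight,
    testBit_lor]
  grind

theorem testBit_act {l : ℕ × List (ℕ × ℕ)} (hl : l ∈ swaps) (m : ℕ) {i : ℕ} (hi : i < 20) :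
    (act l m).testBit i = m.testBit (swapIndex l i) := by
  simp only [swaps, List.mem_cons, List.not_mem_nil, or_false] at hl
  rcases hl with rfl | rfl | rfl | rfl | rfl <;> interval_cases i <;>
  · simp only [act, List.foldl, testBit_lor, testBit_land, Nat.shiftLeft_eq', Nat.shiftRight_eq,
      Nat.testBit_shiftLeft, Nat.testBit_shiftRight]
    generalize Nat.testBit m = b
    simp [Nat.testBit, swapIndex, Nat.shiftRight_eq_div_pow]

theorem swapIndex_spec : ∀ l ∈ swaps, ∀ i < 20, swapIndex l i < 20 ∧
    swapIndex l (swapIndex l i) = i := by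
  decide +kernel

/-- The bits from 16 on are the triples of `{1, 2, 3, 4}`, a set preserved by these transpositions.
A decrease visible there persists whatever the lower bits are, so the search can stop early. -/
theorem swapIndex_take_three : ∀ l ∈ swaps.take 3, ∀ i < 20, 16 ≤ i → 16 ≤ swapIndex l i := by
  decide +kernel

/-- Likewise for the triples of `{1, …, 5}`, which are the bits from 10 on. -/
theorem swapIndex_take_four : ∀ l ∈ swaps.take 4, ∀ i < 20, 10 ≤ i → 10 ≤ swapIndex l i := by
  decide +kernel

/-- This is the symmetry of the system; the faces may come in another order, hence `Perm`. -/
theorem act_tetras : ∀ l ∈ swaps, ∀ t ∈ tetras, ∃ t' ∈ tetras,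
    act l (faces t) = faces t' ∧
      ∀ j < 5, ((faceUnions j t).map (act l)).Perm (faceUnions j t') := by
  decide +kernel

theorem testBit_act_of_le {l : ℕ × List (ℕ × ℕ)} (hl : l ∈ swaps) (m : ℕ) {i : ℕ}
    (hi : 20 ≤ i) : (act l m).testBit i = false :=
  Nat.testBit_lt_two_pow ((act_lt hl m).trans_le (Nat.pow_le_pow_right two_pos hi))

theorem act_mod {l : ℕ × List (ℕ × ℕ)} (hl : l ∈ swaps) (m : ℕ) :
    act l (m % 2 ^ 20) = act l m := by
  refine Nat.eq_of_testBit_eq fun i => ?_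
  rcases lt_or_ge i 20 with hi | hi
  · rw [testBit_act hl _ hi, testBit_act hl _ hi, Nat.testBit_mod_two_pow,
      decide_eq_true (swapIndex_spec l hl i hi).1, Bool.true_and]
  · rw [testBit_act_of_le hl _ hi, testBit_act_of_le hl _ hi]

theorem act_act {l : ℕ × List (ℕ × ℕ)} (hl : l ∈ swaps) (m : ℕ) :
    act l (act l m) = m % 2 ^ 20 := by
  refine Nat.eq_of_testBit_eq fun i => ?_
  rw [Nat.testBit_mod_two_pow]
  rcases lt_or_ge i 20 with hi | hi
  · obtain ⟨h1, h2⟩ := swapIndex_spec l hl i hi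
    rw [testBit_act hl _ hi, testBit_act hl _ h1, h2, decide_eq_true hi, Bool.true_and]
  · rw [testBit_act_of_le hl _ hi, decide_eq_false (by omega), Bool.false_and]

theorem act_and_eq_zero {l : ℕ × List (ℕ × ℕ)} (hl : l ∈ swaps) {m x : ℕ} (h : m &&& x = 0) :
    act l m &&& act l x = 0 := by
  refine Nat.eq_of_testBit_eq fun i => ?_
  rw [Nat.testBit_and, Nat.zero_testBit]
  rcases lt_or_ge i 20 with hi | hi
  · rw [testBit_act hl _ hi, testBit_act hl _ hi, ← Nat.testBit_and, h, Nat.zero_testBit]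
  · rw [testBit_act_of_le hl _ hi, Bool.false_and]

theorem IsSolution.comp_act {F : ℕ → ℤ} (hF : IsSolution F) {l : ℕ × List (ℕ × ℕ)}
    (hl : l ∈ swaps) : IsSolution fun m => F (act l m) where
  mod_eq m := by rw [act_mod hl]
  sum_eq_zero t ht j hj m hm := by
    obtain ⟨t', ht', hf, hp⟩ := act_tetras l hl t ht
    have h0 := hF.sum_eq_zero t' ht' j hj (act l m) (hf ▸ act_and_eq_zero hl hm)
    rw [← ((hp j hj).map _).sum_eq, List.map_map] at h0
    rw [← h0]
    refine congrArg List.sum (List.map_congr_left fun x _ => ?_)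
    exact congrArg F (act_lor hl m x)

/-! ### Values forced by the relations. -/

theorem sum_without {k : ℕ} {L : List ℕ} (h : elem k L = true) (F : ℕ → ℤ) :
    (L.map F).sum = F k + ((without k L).map F).sum := by
  induction L with
  | nil => simp [elem] at h
  | cons x xs ih =>
    by_cases hx : k = x
    · subst hx
      simp [without]
    · have hb : Nat.beq k x = false := by
        rw [← Bool.not_eq_true, Nat.beq_eq]
        exact hx
      have h' : elem k xs = true := by simpa [elem, hb] using h
      simp only [without, hb, cond_false, List.map_cons, List.sum_cons, ih h']
      ring

theorem IsSolution.sum_family {F : ℕ → ℤ} (hF : IsSolution F) {t : ℕ × ℕ × ℕ × ℕ}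
    (ht : t ∈ tetras) (m : ℕ) : ((family m t).map F).sum = 0 := by
  rw [family, List.map_map]
  rcases lt_or_ge (level m t) 5 with hj | hj
  · refine hF.sum_eq_zero t ht _ hj _ (Nat.eq_of_testBit_eq fun i => ?_)
    rw [Nat.testBit_and, testBit_xor, testBit_land, Nat.zero_testBit]
    cases m.testBit i <;> cases (faces t).testBit i <;> rfl
  -- A tetrahedron has four faces, but this bound need not be proved: beyond it the family is empty.
  · obtain ⟨k, hk⟩ := Nat.exists_eq_add_of_le hj
    have h0 : faceUnions (k + 5) t = [] := rfl
    rw [hk, Nat.add_comm, h0]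
    rfl

theorem exists_faces_eq : ∀ L ∈ faceMasks, ∀ f ∈ L, ∃ t ∈ tetras, faces t = f := by
  decide +kernel

/-- The relations with no face or all four faces have a single term. -/
theorem IsSolution.eq_zero_of_constantOn {F : ℕ → ℤ} (hF : IsSolution F) {L : List ℕ}
    (hL : L ∈ faceMasks) {f : ℕ} (hf : f ∈ L) {m : ℕ} (h : constantOn m f = true) : F m = 0 := by
  obtain ⟨t, ht, rfl⟩ := exists_faces_eq L hL f hf
  rw [constantOn, Bool.or_eq_true, Nat.beq_eq, Nat.beq_eq] at h
  rcases h with h | h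
  · simpa [faceUnions] using hF.sum_eq_zero t ht 0 (by norm_num) m h
  · have h0 := hF.sum_eq_zero t ht 4 (by norm_num) (Nat.xor m (faces t)) ?_
    · have h1 : Nat.xor m (faces t) ||| faces t = m := by
        refine Nat.eq_of_testBit_eq fun i => ?_
        have := congrArg (fun x => Nat.testBit x i) h
        simp only [testBit_land] at this
        rw [Nat.testBit_or, testBit_xor]
        revert this
        cases m.testBit i <;> cases (faces t).testBit i <;> decide
      change F (Nat.xor m (faces t) ||| faces t) + 0 = 0 at h0
      rwa [h1, add_zero] at h0
    · refine Nat.eq_of_testBit_eq fun i => ?_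
      have := congrArg (fun x => Nat.testBit x i) h
      simp only [testBit_land] at this
      rw [Nat.testBit_and, testBit_xor, Nat.zero_testBit]
      revert this
      cases m.testBit i <;> cases (faces t).testBit i <;> decide

theorem IsSolution.eq_zero_of_isMono {F : ℕ → ℤ} (hF : IsSolution F) {m : ℕ}
    (h : isMono m = true) : F m = 0 := by
  simp only [isMono, List.any_eq_true] at h
  obtain ⟨L, hL, f, hf, h⟩ := h
  exact hF.eq_zero_of_constantOn hL hf h

theorem sum_map_eq_zero {F : ℕ → ℤ} {L : List ℕ} (h : ∀ k ∈ L, F k = 0) :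
    (L.map F).sum = 0 :=
  List.sum_eq_zero (by simpa using h)

theorem IsSolution.eq_zero_of_isZero {F : ℕ → ℤ} (hF : IsSolution F) {m : ℕ}
    (h : isZero m = true) : F m = 0 := by
  simp only [isZero, List.any_eq_true, Bool.and_eq_true, List.all_eq_true] at h
  obtain ⟨t, ht, hm, h⟩ := h
  have h0 := hF.sum_family ht m
  rwa [sum_without hm, sum_map_eq_zero fun k hk => hF.eq_zero_of_isMono (h k hk), add_zero] at h0

/-- Each move uses a relation in which all terms but two vanish, so it changes the sign. -/
theorem IsSolution.eq_of_path {F : ℕ → ℤ} (hF : IsSolution F) {p : List (ℕ × ℕ)} {m e : ℕ}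
    (h : path m p e = true) : F e = (-1) ^ p.length * F m := by
  induction p generalizing m with
  | nil =>
    rw [path, Nat.beq_eq] at h
    simp [h]
  | cons q p ih =>
    obtain ⟨t, k⟩ := q
    rw [path] at h
    split at h
    · simp at h
    · rename_i t' ht
      simp only [Bool.and_eq_true, List.all_eq_true, Bool.or_eq_true] at h
      obtain ⟨⟨⟨hm, hk⟩, hz⟩, hp⟩ := h
      have h0 := hF.sum_family (List.mem_of_getElem? ht) m
      rw [sum_without hm, sum_without hk, sum_map_eq_zero fun k hk =>
        (hz k hk).elim hF.eq_zero_of_isMono hF.eq_zero_of_isZero] at h0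
      rw [ih hp, List.length_cons, pow_succ]
      linear_combination (-1) ^ p.length * h0

theorem swapPaths_even : ∀ q ∈ swapPaths, Even q.length := by
  decide

theorem exists_mem_zip : ∀ l ∈ swaps, ∃ q, (l, q) ∈ swaps.zip swapPaths := by
  simp [swaps, swapPaths]

theorem IsSolution.act_baseMask {F : ℕ → ℤ} (hF : IsSolution F) {l : ℕ × List (ℕ × ℕ)}
    (hl : l ∈ swaps) : F (act l baseMask) = F baseMask := by
  obtain ⟨q, hq⟩ := exists_mem_zip l hl
  have := hF.eq_of_path (List.all_eq_true.1 swapPaths_spec _ hq)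
  rwa [(swapPaths_even q (List.of_mem_zip hq).2).neg_one_pow, one_mul] at this

/-- Composing a solution with the transposition gives a solution with the same value at `baseMask`.
-/
theorem Forced.act {m : ℕ} {v : ℤ} (h : Forced m v) {l : ℕ × List (ℕ × ℕ)} (hl : l ∈ swaps) :
    Forced (act l m) v := fun F hF => by
  rw [← hF.act_baseMask hl]
  exact h _ (hF.comp_act hl)

theorem Forced.of_act {m : ℕ} {v : ℤ} {l : ℕ × List (ℕ × ℕ)} (hl : l ∈ swaps)
    (h : Forced (TripleMask.act l m) v) : Forced m v := fun F hF => by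
  rw [← hF.mod_eq, ← act_act hl]
  exact h.act hl F hF

theorem Forced.of_descend {n m : ℕ} {v : ℤ} (h : Forced (descend n m) v) : Forced m v := by
  induction n generalizing m with
  | zero => exact h
  | succ n ih =>
    rw [descend] at h
    split at h
    · exact h
    · rename_i l hl
      exact .of_act (List.mem_of_find?_eq_some hl) (ih h)

theorem descend_baseMask : descend 40 baseMask = 89954 := by
  decide +kernel

theorem forced_descend {n m : ℕ} {v : ℤ} (h : Forced m v) : Forced (descend n m) v := by
  induction n generalizing m with
  | zero => exact h
  | succ n ih =>
    rw [descend]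
    split
    · exact h
    · rename_i l hl
      exact ih (h.act (List.mem_of_find?_eq_some hl))

theorem forced_of_entry {T : List (ℕ × ℤ × ℕ)} (hT : ∀ e ∈ T, Forced e.1 e.2.1) {k : ℕ} {v : ℤ}
    (h : entry k T = some v) : Forced k v := by
  induction T with
  | nil => simp [entry] at h
  | cons e es ih =>
    rw [entry] at h
    cases hb : Nat.beq k e.1 with
    | true =>
      rw [hb, cond_true, Option.some_inj] at h
      rw [Nat.beq_eq] at hb
      rw [hb, ← h]
      exact hT e List.mem_cons_self
    | false =>
      rw [hb, cond_false] at h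
      exact ih (fun e he => hT e (List.mem_cons_of_mem _ he)) h

theorem forced_of_value {T : List (ℕ × ℤ × ℕ)} (hT : ∀ e ∈ T, Forced e.1 e.2.1) {k : ℕ} {v : ℤ}
    (h : value T k = some v) : Forced k v := by
  rw [value] at h
  cases hb : isMono k with
  | true =>
    rw [hb, cond_true, Option.some_inj] at h
    intro F hF
    rw [hF.eq_zero_of_isMono hb, ← h, zero_mul]
  | false =>
    rw [hb, cond_false] at h
    exact (forced_of_entry hT h).of_descend

theorem sum_of_sumValues {T : List (ℕ × ℤ × ℕ)} (hT : ∀ e ∈ T, Forced e.1 e.2.1) {L : List ℕ}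
    {v : ℤ} (h : sumValues T L = some v) {F : ℕ → ℤ} (hF : IsSolution F) :
    (L.map F).sum = v * F baseMask := by
  induction L generalizing v with
  | nil =>
    rw [sumValues, Option.some_inj] at h
    simp [← h]
  | cons k ks ih =>
    rw [sumValues] at h
    split at h
    · rename_i a b ha hb
      rw [List.map_cons, List.sum_cons, ih hb, forced_of_value hT ha F hF, ← Option.some_inj.1 h]
      ring
    · simp at h

/-- In the relation attached to an entry, every other term has a known multiple, which determines
the missing one. -/
theorem forced_of_checkTable {T es : List (ℕ × ℤ × ℕ)} (hT : ∀ e ∈ T, Forced e.1 e.2.1)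
    (h : checkTable T es = true) : ∀ e ∈ es, Forced e.1 e.2.1 := by
  induction es generalizing T with
  | nil => simp
  | cons e es ih =>
    obtain ⟨m, v, t⟩ := e
    rw [checkTable, Bool.and_eq_true] at h
    have hm : Forced m v := by
      have h1 := h.1
      split at h1
      · simp at h1
      · rename_i t' ht
        simp only [Bool.and_eq_true, beq_iff_eq] at h1
        intro F hF
        have h0 := hF.sum_family (List.mem_of_getElem? ht) m
        rw [sum_without h1.1, sum_of_sumValues hT h1.2 hF] at h0
        linarith
    rw [List.forall_mem_cons]
    exact ⟨hm, ih (List.forall_mem_cons.2 ⟨hm, hT⟩) h.2⟩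

theorem forced_table : ∀ e ∈ table ++ [(89954, 1, 0)], Forced e.1 e.2.1 := by
  -- The seed is the end of the descent from `baseMask`, hence the multiple 1; its last component is
  -- never read.
  have h0 : ∀ e ∈ [((89954, 1, 0) : ℕ × ℤ × ℕ)], Forced e.1 e.2.1 := by
    rw [List.forall_mem_singleton, ← descend_baseMask]
    exact forced_descend fun F _ => (one_mul _).symm
  rw [List.forall_mem_append]
  exact ⟨forced_of_checkTable h0 checkTable_table, h0⟩

theorem table_values : ∀ e ∈ table ++ [(89954, 1, 0)],
    e.2.1 ∈ ({-4, -1, 0, 1} : Finset ℤ) := by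
  decide +kernel

/-! ### Exhaustion of the masks with ten bits. -/

/-- The number of bits of `x` below the `n`-th. -/
def bitCount (n x : ℕ) : ℕ := ((Finset.range n).filter fun i => x.testBit i = true).card

theorem bitCount_succ (n x : ℕ) :
    bitCount (n + 1) x = bitCount n x + (x.testBit n).toNat := by
  rw [bitCount, Finset.range_add_one, Finset.filter_insert]
  cases x.testBit n with
  | false => simp [bitCount]
  | true => simp [bitCount]

theorem bitCount_two_pow_add (n y : ℕ) : bitCount n (2 ^ n + y) = bitCount n y := by
  refine congrArg Finset.card (Finset.filter_congr fun i hi => ?_)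
  rw [Nat.testBit_two_pow_add_gt (Finset.mem_range.1 hi)]

theorem bitCount_act {l : ℕ × List (ℕ × ℕ)} (hl : l ∈ swaps) (m : ℕ) :
    bitCount 20 (act l m) = bitCount 20 m := by
  have key := swapIndex_spec l hl
  refine Finset.card_nbij' (swapIndex l) (swapIndex l) ?_ ?_ ?_ ?_
  · intro i hi
    simp only [Finset.coe_filter, Finset.mem_range, Set.mem_ofPred_eq] at hi ⊢
    exact ⟨(key i hi.1).1, testBit_act hl m hi.1 ▸ hi.2⟩
  · intro i hi
    simp only [Finset.coe_filter, Finset.mem_range, Set.mem_ofPred_eq] at hi ⊢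
    refine ⟨(key i hi.1).1, ?_⟩
    rw [testBit_act hl m (key i hi.1).1, (key i hi.1).2]
    exact hi.2
  · intro i hi
    simp only [Finset.coe_filter, Finset.mem_range, Set.mem_ofPred_eq] at hi
    exact (key i hi.1).2
  · intro i hi
    simp only [Finset.coe_filter, Finset.mem_range, Set.mem_ofPred_eq] at hi
    exact (key i hi.1).2

theorem add_shiftRight {n m x : ℕ} (hm : 2 ^ n ∣ m) (hx : x < 2 ^ n) :
    (m + x) >>> n = m >>> n := by
  obtain ⟨c, rfl⟩ := hm
  rw [Nat.shiftRight_eq_div_pow, Nat.shiftRight_eq_div_pow, Nat.mul_add_div (by positivity),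
    Nat.div_eq_of_lt hx, add_zero, Nat.mul_div_cancel_left _ (by positivity)]

theorem testBit_add {n m x i : ℕ} (hm : 2 ^ n ∣ m) (hx : x < 2 ^ n) (hi : n ≤ i) :
    (m + x).testBit i = m.testBit i := by
  obtain ⟨j, rfl⟩ := Nat.exists_eq_add_of_le hi
  rw [← Nat.testBit_shiftRight, ← Nat.testBit_shiftRight, add_shiftRight hm hx]

theorem getD_faceMasks (n : ℕ) : ∀ f ∈ faceMasks.getD n [],
    faceMasks.getD n [] ∈ faceMasks ∧ 2 ^ n ∣ f := by
  rcases lt_or_ge n 17 with hn | hn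
  · revert n
    decide +kernel
  · rw [List.getD_eq_default _ _ hn]
    simp

theorem constantOn_add {n m x f : ℕ} (hm : 2 ^ n ∣ m) (hx : x < 2 ^ n) (hf : 2 ^ n ∣ f) :
    constantOn (m + x) f = constantOn m f := by
  have h : Nat.land (m + x) f = Nat.land m f := by
    refine Nat.eq_of_testBit_eq fun i => ?_
    rw [testBit_land, testBit_land]
    rcases lt_or_ge i n with hi | hi
    · obtain ⟨c, rfl⟩ := hf
      rw [Nat.testBit_two_pow_mul, decide_eq_false (by omega)]
      simp
    · rw [testBit_add hm hx hi]
  rw [constantOn, constantOn, h]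

theorem act_lt_of_descends {n m x : ℕ} (hm : 2 ^ n ∣ m) (hx : x < 2 ^ n)
    {l : ℕ × List (ℕ × ℕ)} (hl : l ∈ swaps) (hn : ∀ i < 20, n ≤ i → n ≤ swapIndex l i)
    (h : descends n l m = true) : act l (m + x) < m + x := by
  have h1 : act l (m + x) >>> n = act l m >>> n := by
    refine Nat.eq_of_testBit_eq fun i => ?_
    rw [Nat.testBit_shiftRight, Nat.testBit_shiftRight]
    rcases lt_or_ge (n + i) 20 with hi | hi
    · rw [testBit_act hl _ hi, testBit_act hl _ hi,
        testBit_add hm hx (hn _ hi (Nat.le_add_right n i))]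
    · rw [testBit_act_of_le hl _ hi, testBit_act_of_le hl _ hi]
  have h2 : act l m >>> n < m >>> n := by
    rw [descends, Nat.blt_eq] at h
    exact h
  rw [← h1, ← add_shiftRight hm hx, Nat.shiftRight_eq_div_pow, Nat.shiftRight_eq_div_pow] at h2
  exact lt_of_not_ge fun h3 => absurd (Nat.div_le_div_right h3) h2.not_ge

/-- The value at `m` is known, or `m` is decreased by an adjacent transposition. -/
def Settled (T : List (ℕ × ℤ × ℕ)) (m : ℕ) : Prop :=
  isMono m = true ∨ (entry m T).isSome = true ∨ ∃ l ∈ swaps, act l m < m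

theorem settled_of_pruned {T : List (ℕ × ℤ × ℕ)} {n m x : ℕ} (hm : 2 ^ n ∣ m)
    (hx : x < 2 ^ n) (h : pruned n m = true) : Settled T (m + x) := by
  simp only [pruned, Bool.or_eq_true, Bool.and_eq_true, List.any_eq_true, Nat.beq_eq] at h
  rcases h with (⟨f, hf, h⟩ | ⟨rfl, l, hl, h⟩) | ⟨rfl, l, hl, h⟩
  · refine Or.inl ?_
    obtain ⟨h1, h2⟩ := getD_faceMasks n f hf
    exact List.any_eq_true.2 ⟨_, h1, List.any_eq_true.2 ⟨f, hf, constantOn_add hm hx h2 ▸ h⟩⟩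
  · exact .inr (.inr ⟨l, List.mem_of_mem_take hl,
      act_lt_of_descends hm hx (List.mem_of_mem_take hl) (swapIndex_take_three l hl) h⟩)
  · exact .inr (.inr ⟨l, List.mem_of_mem_take hl,
      act_lt_of_descends hm hx (List.mem_of_mem_take hl) (swapIndex_take_four l hl) h⟩)

/-- Here `m` carries the bits already chosen and `x` the `k` bits still to be placed below the
`n`-th; the induction follows the search tree. -/
theorem settled_of_covers {T : List (ℕ × ℤ × ℕ)} {n k m x : ℕ} (h : covers T n k m = true)
    (hm : 2 ^ n ∣ m) (hx : x < 2 ^ n) (hk : bitCount n x = k) : Settled T (m + x) := by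
  induction n generalizing k m x with
  | zero =>
    simp only [covers, Bool.or_eq_true] at h
    rcases h with (h | h) | h
    · exact settled_of_pruned hm hx h
    · simp [← hk, bitCount] at h
    · obtain rfl : x = 0 := by omega
      simp only [decided, Bool.or_eq_true, List.any_eq_true, Nat.blt_eq] at h
      simp only [Settled, add_zero]
      tauto
  | succ n ih =>
    rw [covers, Bool.or_eq_true, Bool.and_eq_true, Bool.or_eq_true, Nat.beq_eq] at h
    rcases h with h | ⟨h1, h2⟩
    · exact settled_of_pruned hm hx h
    · have hn : 2 ^ n ∣ m := (pow_dvd_pow 2 n.le_succ).trans hm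
      rw [bitCount_succ] at hk
      rcases lt_or_ge x (2 ^ n) with hlt | hge
      · rw [Nat.testBit_lt_two_pow hlt] at hk
        exact ih h1 hn hlt hk
      · obtain ⟨y, rfl⟩ := Nat.exists_eq_add_of_le hge
        have hy : y < 2 ^ n := by
          rw [pow_succ] at hx
          omega
        rw [Nat.testBit_two_pow_add_eq, Nat.testBit_lt_two_pow hy, bitCount_two_pow_add] at hk
        simp only [Bool.not_false, Bool.toNat_true] at hk
        rw [← add_assoc]
        refine ih (h2.resolve_left (by omega)) (dvd_add hn dvd_rfl) hy ?_
        rw [Nat.pred_eq_sub_one]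
        omega

/-- Strong induction on the mask: one whose value is not known directly has a smaller image with as
many bits and the same multiple. -/
theorem exists_forced (m : ℕ) (hm : m < 2 ^ 20) (hc : bitCount 20 m = 10) :
    ∃ v ∈ ({-4, -1, 0, 1} : Finset ℤ), Forced m v := by
  induction m using Nat.strong_induction_on with
  | _ m ih =>
    have h := settled_of_covers covers_table (dvd_zero _) hm hc
    rw [zero_add] at h
    rcases h with h | h | ⟨l, hl, h⟩
    · exact ⟨0, by decide, fun F hF => by rw [hF.eq_zero_of_isMono h, zero_mul]⟩
    · obtain ⟨v, hv⟩ := Option.isSome_iff_exists.1 h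
      refine ⟨v, ?_, forced_of_entry forced_table hv⟩
      have key : ∀ T : List (ℕ × ℤ × ℕ), entry m T = some v → ∃ e ∈ T, e.2.1 = v := by
        intro T
        induction T with
        | nil => simp [entry]
        | cons e es ih =>
          intro h
          rw [entry] at h
          cases hb : Nat.beq m e.1 <;> rw [hb] at h <;> simp_all
      obtain ⟨e, he, rfl⟩ := key _ hv
      exact table_values e he
    · obtain ⟨v, hv, hf⟩ := ih _ h (act_lt hl m) (by rw [bitCount_act hl, hc])
      exact ⟨v, hv, hf.of_act hl⟩

/-! ### The determinantal solution. -/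

/-- The triples of `{1, …, 6}`, in reverse colexicographic order. -/
def triples : List (ℕ × ℕ × ℕ) :=
  [(4, 5, 6), (3, 5, 6), (2, 5, 6), (1, 5, 6), (3, 4, 6), (2, 4, 6), (1, 4, 6),
   (2, 3, 6), (1, 3, 6), (1, 2, 6), (3, 4, 5), (2, 4, 5), (1, 4, 5), (2, 3, 5),
   (1, 3, 5), (1, 2, 5), (2, 3, 4), (1, 3, 4), (1, 2, 4), (1, 2, 3)]

/-- The `i`-th triple. -/
def triple (i : Fin 20) : ℕ × ℕ × ℕ := triples.getD i (0, 0, 0)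

/-- The edges of the boundary which are used as coordinates. -/
def edges : List (ℕ × ℕ) :=
  [(1, 2), (1, 3), (1, 4), (1, 5), (2, 3), (2, 4), (2, 5), (3, 4), (3, 5), (4, 5)]

/-- The coefficient of the `p`-th edge in the boundary of the `i`-th triple. -/
def boundary (i : Fin 20) (p : ℕ) : ℤ :=
  if edges[p]? = some ((triple i).1, (triple i).2.1) then 1 else
    if edges[p]? = some ((triple i).1, (triple i).2.2) then -1 else
      if edges[p]? = some ((triple i).2.1, (triple i).2.2) then 1 else 0

/-- The tensor product of the boundary of a triple with a vector of the plane. -/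
def row (u : Fin 2 → ℤ) (i q : Fin 20) : ℤ :=
  boundary i (q / 2) * u (if (q : ℕ) % 2 = 0 then 0 else 1)

/-- The inverse of the matrix of `P^(1)`. -/
def baseInverse : List (List ℤ) :=
  [[0, 0, -1, 1, 0, 0, 0, 0, 0, 0, 0, 0, 0, 0, 0, 1, 0, 0, 0, 0],
   [0, 0, 0, 0, 0, 0, 0, 0, 0, 1, 0, 0, 0, 0, 0, 0, 0, 0, 0, 0],
   [0, 0, -1, 1, -1, 1, 0, 0, 0, 0, 0, 0, 0, 0, 0, 1, 0, 1, -1, 0],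
   [0, 0, 0, 0, 0, 0, 0, 0, 1, 0, 0, 0, 0, 0, 0, 0, 0, 0, 0, 0],
   [0, 0, -1, 1, 0, 1, 0, 0, 0, 0, 0, 0, 0, 0, 0, 1, 0, 0, -1, 0],
   [0, 0, 0, 0, 0, 0, 1, 0, 0, 0, 0, 0, 0, 0, 0, 0, 0, 0, 0, 0],
   [0, 0, 0, 1, 0, 0, 0, 0, 0, 0, 0, 0, 0, 0, 0, 0, 0, 0, 0, 0],
   [0, 1, 0, 0, 0, 0, 0, 0, 1, 0, 0, 0, 0, 0, -1, 0, 0, 0, 0, 0],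
   [0, 0, 0, 0, -1, 1, 0, 0, 0, 0, 0, 0, 0, 0, 0, 0, 0, 1, -1, 1],
   [0, 0, 0, 0, 0, 0, 0, 1, 0, 0, 0, 0, 0, 0, 0, 0, 0, 0, 0, 0],
   [0, 0, 0, 0, 0, 1, 0, 0, 0, 0, 0, 0, 0, 0, 0, 0, 0, 0, 0, 0],
   [0, 0, 0, 0, 0, 0, 1, 1, -1, 0, 0, 1, -1, -1, 1, 0, 0, 0, 0, 0],
   [0, 0, 1, 0, 0, 0, 0, 0, 0, 0, 0, 0, 0, 0, 0, 0, 0, 0, 0, 0],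
   [0, 1, 0, 0, 0, 0, 0, 1, 0, 0, 0, 0, 0, -1, 0, 0, 0, 0, 0, 0],
   [0, 0, 0, 0, 1, 0, 0, 0, 0, 0, 0, 0, 0, 0, 0, 0, 0, 0, 0, 0],
   [0, 0, 0, 0, 0, 0, 1, 0, -1, 0, 0, 1, -1, -1, 1, 0, 1, 0, 0, 0],
   [1, 0, 0, 0, 1, 0, 0, 0, 0, 0, -1, 0, 0, 0, 0, 0, 0, 0, 0, 0],
   [0, 1, 0, 0, 0, 0, 0, 0, 0, 0, 0, 0, 0, 0, 0, 0, 0, 0, 0, 0],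
   [1, 0, 0, 0, 0, 0, 0, 0, 0, 0, 0, 0, 0, 0, 0, 0, 0, 0, 0, 0],
   [0, 1, 0, 0, 0, 0, -1, 0, 1, 0, 0, 0, 1, 0, -1, 0, 0, 0, 0, 0]]

/-- The set of the triples in a mask. -/
def bits (m : ℕ) : Finset (Fin 20) := Finset.univ.filter fun i => m.testBit i = true

/-- The matrix of a set of triples, the first part of a partition. -/
def rows (S : Finset (Fin 20)) : Fin 20 → Fin 20 → ℤ :=
  S.piecewise (row ![1, 0]) (row ![0, 1])

theorem rows_mul_baseInverse : ∀ i j : Fin 20,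
    ∑ k : Fin 20, (if baseMask.testBit i = true then row ![1, 0] i k else row ![0, 1] i k) *
      (baseInverse.getD k []).getD j 0 = if i = j then 1 else 0 := by
  decide +kernel

theorem det_rows_baseMask : (Matrix.of (rows (bits baseMask))).det ≠ 0 := by
  have h : Matrix.of (rows (bits baseMask)) *
      (Matrix.of fun k j : Fin 20 => (baseInverse.getD k []).getD j 0) = 1 := by
    ext i j
    rw [Matrix.mul_apply, Matrix.one_apply, ← rows_mul_baseInverse i j]
    refine Finset.sum_congr rfl fun k _ => ?_
    have hk : i ∈ bits baseMask ↔ baseMask.testBit i = true := by simp [bits]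
    simp only [Matrix.of_apply, rows, Finset.piecewise, hk]
    split_ifs <;> rfl
  intro h0
  have := congrArg Matrix.det h
  rw [Matrix.det_mul, h0, zero_mul, Matrix.det_one] at this
  exact zero_ne_one this

/-- The coefficients of the relation between the boundaries of the faces of a tetrahedron. -/
def faceSign (t : ℕ × ℕ × ℕ × ℕ) (i : Fin 20) : ℤ :=
  (t.1.testBit i).toNat - (t.2.1.testBit i).toNat + (t.2.2.1.testBit i).toNat -
    (t.2.2.2.testBit i).toNat

/-- The boundary of the boundary of a tetrahedron is zero. -/
theorem sum_faceSign : ∀ t ∈ tetras, ∀ p < 10, ∑ i, faceSign t i * boundary i p = 0 := by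
  decide +kernel

theorem faceSign_support : ∀ t ∈ tetras, ∀ i : Fin 20, faceSign t i ≠ 0 → i ∈ bits (faces t) := by
  decide +kernel

theorem exists_faceSign_ne_zero : ∀ t ∈ tetras, ∃ i, faceSign t i ≠ 0 := by
  decide +kernel

theorem det_eq_zero_of_faces {t : ℕ × ℕ × ℕ × ℕ} (ht : t ∈ tetras) (u : Fin 2 → ℤ)
    (M : Fin 20 → Fin 20 → ℤ) (hM : ∀ i ∈ bits (faces t), M i = row u i) :
    (Matrix.of M).det = 0 := by
  refine Matrix.exists_vecMul_eq_zero_iff.1 ⟨faceSign t, ?_, ?_⟩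
  · obtain ⟨i, hi⟩ := exists_faceSign_ne_zero t ht
    exact fun h => hi (congrFun h i)
  · funext q
    have h := sum_faceSign t ht (q / 2) (by omega)
    calc ∑ i, faceSign t i * M i q
        = ∑ i, (faceSign t i * boundary i (q / 2)) * u (if (q : ℕ) % 2 = 0 then 0 else 1) := by
          refine Finset.sum_congr rfl fun i _ => ?_
          by_cases hi : faceSign t i = 0
          · rw [hi]; ring
          · rw [hM i (faceSign_support t ht i hi), row]; ring
      _ = 0 := by rw [← Finset.sum_mul, h, zero_mul]

/-- By multilinearity, the sum is the coefficient of `x ^ j` in the determinant of `h`, a polynomial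
in `x` that vanishes at every integer. -/
theorem sum_powersetCard_det_piecewise {n : Type*} [Fintype n] [DecidableEq n] (A C : n → n → ℤ)
    (τ : Finset n) (h : ∀ x : ℤ,
      (Matrix.of (τ.piecewise ((fun i => x • A i) + C) C)).det = 0) (j : ℕ) :
    ∑ S ∈ τ.powersetCard j, (Matrix.of (S.piecewise A C)).det = 0 := by
  let D : MultilinearMap ℤ (fun _ : n => n → ℤ) ℤ :=
    (Matrix.detRowAlternating (R := ℤ) (n := n)).toMultilinearMap
  have hD : ∀ M : n → n → ℤ, D M = (Matrix.of M).det := fun _ => rfl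
  have key : ∀ x : ℤ, ∑ S ∈ τ.powerset, x ^ S.card * (Matrix.of (S.piecewise A C)).det = 0 := by
    intro x
    rw [← h x, ← hD, D.map_piecewise_add]
    refine Finset.sum_congr rfl fun S _ => ?_
    have h3 := D.map_piecewise_smul (fun _ => x) (S.piecewise A C) S
    rw [Finset.prod_const, hD (S.piecewise A C), smul_eq_mul] at h3
    rw [← h3]
    refine congrArg D ?_
    funext i
    simp only [Finset.piecewise]
    split_ifs <;> rfl
  have hp : ∑ S ∈ τ.powerset,
      Polynomial.monomial S.card (Matrix.of (S.piecewise A C)).det = 0 := by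
    refine Polynomial.funext fun x => ?_
    rw [Polynomial.eval_finsetSum, Polynomial.eval_zero, ← key x]
    exact Finset.sum_congr rfl fun S _ => by rw [Polynomial.eval_monomial, mul_comm]
  have hc := congrArg (fun p => Polynomial.coeff p j) hp
  simp only [Polynomial.finsetSum_coeff, Polynomial.coeff_monomial, Polynomial.coeff_zero] at hc
  rwa [← Finset.sum_filter, ← Finset.powersetCard_eq_filter] at hc

theorem sum_det_rows {t : ℕ × ℕ × ℕ × ℕ} (ht : t ∈ tetras) (j : ℕ) (R : Finset (Fin 20))
    (hR : Disjoint R (bits (faces t))) :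
    ∑ S ∈ (bits (faces t)).powersetCard j, (Matrix.of (rows (R ∪ S))).det = 0 := by
  rw [← sum_powersetCard_det_piecewise (row ![1, 0]) (rows R) (bits (faces t)) (fun x => ?_) j]
  · refine Finset.sum_congr rfl fun S _ => congrArg (fun M => (Matrix.of M).det) ?_
    funext i
    simp only [rows, Finset.piecewise, Finset.mem_union]
    split_ifs <;> tauto
  -- As `R` avoids the faces, their rows in `rows R` carry `(0, 1)`; adding `x` times `(1, 0)` gives
  -- `(x, 1)`.
  · refine det_eq_zero_of_faces ht ![x, 1] _ fun i hi => ?_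
    have hiR : i ∉ R := Finset.disjoint_right.1 hR hi
    rw [Finset.piecewise_eq_of_mem _ _ _ hi, Pi.add_apply, rows,
      Finset.piecewise_eq_of_notMem _ _ _ hiR]
    funext q
    simp only [Pi.add_apply, Pi.smul_apply, smul_eq_mul, row]
    split_ifs
    · simp; ring
    · simp

/-- Functions of sets of triples satisfying the relations of all tetrahedra. -/
def IsSetSolution (G : Finset (Fin 20) → ℤ) : Prop :=
  ∀ t ∈ tetras, ∀ (j : ℕ) (R : Finset (Fin 20)), Disjoint R (bits (faces t)) →
    ∑ S ∈ (bits (faces t)).powersetCard j, G (R ∪ S) = 0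

theorem bits_faceUnions : ∀ t ∈ tetras, ∀ j < 5, ((faceUnions j t).map bits).Nodup ∧
    ((faceUnions j t).map bits).toFinset = (bits (faces t)).powersetCard j := by
  decide +kernel

theorem IsSetSolution.isSolution {G : Finset (Fin 20) → ℤ} (hG : IsSetSolution G) :
    IsSolution fun m => G (bits m) where
  mod_eq m := congrArg G (Finset.filter_congr fun i _ => by
    rw [Nat.testBit_mod_two_pow, decide_eq_true i.2, Bool.true_and])
  sum_eq_zero t ht j hj m hm := by
    obtain ⟨h1, h2⟩ := bits_faceUnions t ht j hj
    have h := hG t ht j (bits m) ?_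
    · rw [← h2, List.sum_toFinset _ h1, List.map_map] at h
      rw [← h]
      refine congrArg List.sum (List.map_congr_left fun x _ => congrArg G ?_)
      ext i
      simp [bits]
    · rw [Finset.disjoint_left]
      intro i h1 h2
      have h3 := congrArg (fun k => k.testBit i) hm
      simp only [bits, Finset.mem_filter, Finset.mem_univ, true_and] at h1 h2
      simp [h1, h2] at h3

/-- All sets in one relation have the same size, so the function may be set to zero off size ten. -/
theorem isSetSolution_det : IsSetSolution fun S =>
    if S.card = 10 then (Matrix.of (rows S)).det else 0 := by
  intro t ht j R hR
  by_cases hj : R.card + j = 10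
  · rw [← sum_det_rows ht j R hR]
    refine Finset.sum_congr rfl fun S hS => if_pos ?_
    rw [Finset.mem_powersetCard] at hS
    rw [Finset.card_union_of_disjoint (hR.mono_right hS.1), hS.2, hj]
  · refine Finset.sum_eq_zero fun S hS => if_neg ?_
    rw [Finset.mem_powersetCard] at hS
    rwa [Finset.card_union_of_disjoint (hR.mono_right hS.1), hS.2]

theorem exists_bits_eq (S : Finset (Fin 20)) : ∃ m < 2 ^ 20, bits m = S := by
  refine ⟨Nat.ofBits fun i => decide (i ∈ S), Nat.ofBits_lt_two_pow _, ?_⟩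
  ext i
  simp [bits]

theorem bitCount_eq_card_bits (m : ℕ) : bitCount 20 m = (bits m).card := by
  rw [bitCount, ← Finset.card_map Fin.valEmbedding]
  refine congrArg Finset.card ?_
  ext i
  simp only [bits, Finset.mem_filter, Finset.mem_range, Finset.mem_map, Finset.mem_univ, true_and,
    Fin.valEmbedding_apply]
  exact ⟨fun h => ⟨⟨i, h.1⟩, h.2, rfl⟩, by rintro ⟨j, hj, rfl⟩; exact ⟨j.2, hj⟩⟩

theorem exists_value (S : Finset (Fin 20)) (hS : S.card = 10) :
    ∃ v ∈ ({-4, -1, 0, 1} : Finset ℤ), ∀ G, IsSetSolution G → G S = v * G (bits baseMask) := by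
  obtain ⟨m, hm, rfl⟩ := exists_bits_eq S
  obtain ⟨v, hv, h⟩ := exists_forced m hm (by rw [bitCount_eq_card_bits, hS])
  exact ⟨v, hv, fun G hG => h _ hG.isSolution⟩

theorem card_bits_baseMask : (bits baseMask).card = 10 := by
  decide +kernel

/-- The solution equal to `1` at `P^(1)` exists and is unique. -/
theorem exists_setSolution : ∃ G, IsSetSolution G ∧ (∀ S, G S ∈ ({-4, -1, 0, 1} : Finset ℤ)) ∧
    G (bits baseMask) = 1 ∧
    ∀ G', IsSetSolution G' → G' (bits baseMask) = 1 → ∀ S, S.card = 10 → G' S = G S := by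
  choose! v hv h using exists_value
  refine ⟨fun S => if S.card = 10 then v S else 0, ?_, ?_, ?_, ?_⟩
  · intro t ht j R hR
    -- Multiplied by the determinant at `P^(1)`, the relation for the multiples becomes the one for
    -- the determinant.
    refine (mul_eq_zero.1 ?_).resolve_right det_rows_baseMask
    rw [Finset.sum_mul]
    refine Eq.trans (Finset.sum_congr rfl fun S _ => ?_) (isSetSolution_det t ht j R hR)
    by_cases hS : (R ∪ S).card = 10
    · have := h _ hS _ isSetSolution_det
      simp only [if_pos hS, if_pos card_bits_baseMask] at this ⊢
      exact this.symm
    · simp only [if_neg hS, zero_mul]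
  · intro S
    dsimp only
    split_ifs with hS
    · exact hv S hS
    · decide
  · have := h _ card_bits_baseMask _ isSetSolution_det
    simp only [if_pos card_bits_baseMask] at this ⊢
    exact mul_right_cancel₀ det_rows_baseMask (this.symm.trans (one_mul _).symm)
  · intro G' hG' h1 S hS
    simp only [if_pos hS]
    rw [h S hS G' hG', h1, mul_one]

/-! ### Translation between partitions and sets of triples. -/

/-- The `i`-th triple, as a set. -/
def tripleFinset (i : Fin 20) : Finset ℕ := {(triple i).1, (triple i).2.1, (triple i).2.2}

theorem tripleFinset_injective : Function.Injective tripleFinset := by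
  unfold Function.Injective
  decide +kernel

theorem image_tripleFinset :
    Finset.univ.image tripleFinset = Finset.powersetCard 3 (Finset.Icc 1 6) := by
  decide +kernel

theorem exists_tetra : ∀ x y z w : Fin 7, 1 ≤ x ∧ x < y ∧ y < z ∧ z < w →
    ∃ t ∈ tetras, ∀ i, tripleFinset i ∈
      ({{x.1, y.1, z.1}, {x.1, y.1, w.1}, {x.1, z.1, w.1}, {y.1, z.1, w.1}} :
        Finset (Finset ℕ)) ↔ i ∈ bits (faces t) := by
  decide +kernel

theorem exists_vertices : ∀ t ∈ tetras, ∃ x < 7, 1 ≤ x ∧ ∃ y < 7, x < y ∧ ∃ z < 7, y < z ∧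
    ∃ w < 7, z < w ∧ ∀ i, tripleFinset i ∈
      ({{x, y, z}, {x, y, w}, {x, z, w}, {y, z, w}} : Finset (Finset ℕ)) ↔ i ∈ bits (faces t) := by
  decide +kernel

/-- The `i`-th triple, as a hyperedge. -/
def edge (i : Fin 20) : Set ℕ := tripleFinset i

theorem edge_injective : Function.Injective edge :=
  Finset.coe_injective.comp tripleFinset_injective

theorem edge_mem_tetraFaces (i : Fin 20) (x y z w : ℕ) : edge i ∈ tetraFaces x y z w ↔
    tripleFinset i ∈
      ({{x, y, z}, {x, y, w}, {x, z, w}, {y, z, w}} : Finset (Finset ℕ)) := by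
  simp only [tetraFaces, edge, Set.mem_insert_iff, Set.mem_singleton_iff, Finset.mem_insert,
    Finset.mem_singleton, ← Finset.coe_inj, Finset.coe_insert, Finset.coe_singleton]

theorem mem_edgeSet_iff (e : Set ℕ) : e ∈ (completeUniform 6 3).edgeSet ↔ ∃ i, edge i = e := by
  have key : ∀ f : Finset ℕ, (∃ i, tripleFinset i = f) ↔ f ⊆ Finset.Icc 1 6 ∧ f.card = 3 := by
    intro f
    rw [← Finset.mem_powersetCard, ← image_tripleFinset]
    simp
  constructor
  · rintro ⟨h1, h2⟩
    obtain ⟨f, rfl⟩ := ((Set.finite_Icc 1 6).subset h1).exists_finset_coe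
    rw [Set.encard_coe_eq_coe_finsetCard] at h2
    obtain ⟨i, hi⟩ := (key f).2 ⟨by rw [← Finset.coe_subset]; simpa using h1, by exact_mod_cast h2⟩
    exact ⟨i, by rw [edge, hi]⟩
  · rintro ⟨i, rfl⟩
    obtain ⟨h1, h2⟩ := (key _).1 ⟨i, rfl⟩
    refine ⟨?_, by rw [edge, Set.encard_coe_eq_coe_finsetCard, h2]⟩
    rw [← Finset.coe_subset, Finset.coe_Icc] at h1
    exact h1

theorem edge_mem_part_zero_or_one (P : HypergraphPartition (completeUniform 6 3) 2) (i : Fin 20) :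
    edge i ∈ (P.part 1).edgeSet ↔ edge i ∉ (P.part 0).edgeSet := by
  have h1 := P.disjoint_part 0 1 (by decide)
  have h2 : edge i ∈ ⋃ k, (P.part k).edgeSet := P.iUnion_part ▸ (mem_edgeSet_iff _).2 ⟨i, rfl⟩
  rw [Set.mem_iUnion, Fin.exists_fin_two] at h2
  exact ⟨fun h h' => Set.disjoint_left.1 h1 h' h, h2.resolve_left⟩

open Classical in
/-- The set of the triples in the first part of a partition. -/
noncomputable def firstPart (P : HypergraphPartition (completeUniform 6 3) 2) :
    Finset (Fin 20) :=
  Finset.univ.filter fun i => edge i ∈ (P.part 0).edgeSet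

theorem mem_firstPart {P : HypergraphPartition (completeUniform 6 3) 2} {i : Fin 20} :
    i ∈ firstPart P ↔ edge i ∈ (P.part 0).edgeSet := by
  simp [firstPart]

theorem edgeSet_part (P : HypergraphPartition (completeUniform 6 3) 2) (k : Fin 2) :
    (P.part k).edgeSet = edge '' {i | edge i ∈ (P.part k).edgeSet} := by
  ext e
  constructor
  · intro he
    obtain ⟨i, rfl⟩ := (mem_edgeSet_iff e).1 (P.iUnion_part ▸ Set.mem_iUnion.2 ⟨k, he⟩)
    exact ⟨i, he, rfl⟩
  · rintro ⟨i, hi, rfl⟩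
    exact hi

theorem edgeSet_part_zero (P : HypergraphPartition (completeUniform 6 3) 2) :
    (P.part 0).edgeSet = edge '' firstPart P := by
  rw [edgeSet_part]
  congr 1
  ext i
  simp [mem_firstPart]

theorem edgeSet_part_one (P : HypergraphPartition (completeUniform 6 3) 2) :
    (P.part 1).edgeSet = edge '' ((firstPart P)ᶜ : Finset (Fin 20)) := by
  rw [edgeSet_part]
  congr 1
  ext i
  simp [mem_firstPart, edge_mem_part_zero_or_one]

theorem firstPart_injective : Function.Injective firstPart := by
  intro P Q h
  ext1
  funext k
  refine Hypergraph.ext ((P.vertexSet_part k).trans (Q.vertexSet_part k).symm) ?_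
  revert k
  rw [Fin.forall_fin_two, edgeSet_part_zero, edgeSet_part_zero, edgeSet_part_one,
    edgeSet_part_one, h]
  exact ⟨rfl, rfl⟩

theorem card_firstPart (P : HomPartition) : (firstPart P.1).card = 10 := by
  have h := P.2 0 1
  rw [edgeSet_part_zero, edgeSet_part_one, edge_injective.encard_image,
    edge_injective.encard_image, Set.encard_coe_eq_coe_finsetCard,
    Set.encard_coe_eq_coe_finsetCard, Nat.cast_inj, Finset.card_compl, Fintype.card_fin] at h
  omega

theorem exists_firstPart_eq {A : Finset (Fin 20)} (hA : A.card = 10) :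
    ∃ P : HomPartition, firstPart P.1 = A := by
  let P : HypergraphPartition (completeUniform 6 3) 2 :=
    { part := fun k =>
        { vertexSet := Set.Icc 1 6
          edgeSet := edge '' ((if k = 0 then A else Aᶜ : Finset (Fin 20)) : Set (Fin 20))
          subset_vertexSet_of_mem_edgeSet' := by
            rintro _ ⟨i, -, rfl⟩
            exact ((mem_edgeSet_iff _).2 ⟨i, rfl⟩).1 }
      vertexSet_part := fun _ => rfl
      disjoint_part := by
        intro k l hkl
        rw [Set.disjoint_image_iff edge_injective, Finset.disjoint_coe]
        by_cases hk : k = 0 <;> by_cases hl : l = 0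
        · exact absurd (hk.trans hl.symm) hkl
        · simpa [hk, hl] using disjoint_compl_right
        · simpa [hk, hl] using disjoint_compl_left
        · exact absurd (by omega) hkl
      iUnion_part := by
        ext e
        rw [mem_edgeSet_iff, Set.mem_iUnion, Fin.exists_fin_two]
        constructor
        · rintro (⟨i, -, h⟩ | ⟨i, -, h⟩) <;> exact ⟨i, h⟩
        · rintro ⟨i, rfl⟩
          by_cases hi : i ∈ A
          · exact .inl ⟨i, by simpa using hi, rfl⟩
          · exact .inr ⟨i, by simpa using hi, rfl⟩ }
  have h0 : firstPart P = A := by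
    ext i
    rw [mem_firstPart]
    exact edge_injective.mem_set_image.trans (by simp)
  refine ⟨⟨P, ?_⟩, h0⟩
  have h1 : ∀ k, (P.part k).edgeSet.encard = 10 := by
    rw [Fin.forall_fin_two, edgeSet_part_zero, edgeSet_part_one, edge_injective.encard_image,
      edge_injective.encard_image, Set.encard_coe_eq_coe_finsetCard,
      Set.encard_coe_eq_coe_finsetCard, Finset.card_compl, Fintype.card_fin, h0, hA]
    exact ⟨rfl, rfl⟩
  exact fun k l => (h1 k).trans (h1 l).symm

theorem mem_pair_iff {x y z w : ℕ} {τ : Finset (Fin 20)}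
    (h : ∀ i, edge i ∈ tetraFaces x y z w ↔ i ∈ τ) {K P : HomPartition} :
    K ∈ pair P x y z w ↔ firstPart K.1 \ τ = firstPart P.1 \ τ := by
  classical
  rw [pair, Finset.mem_filter, Finset.ext_iff]
  simp only [Finset.mem_univ, true_and, mem_edgeSet_iff, forall_exists_index,
    forall_apply_eq_imp_iff, h, Fin.forall_fin_two, edge_mem_part_zero_or_one, ← mem_firstPart,
    Finset.mem_sdiff]
  exact forall_congr' fun i => by tauto

/-- A member of the pair set is determined by the faces in its first part, and homogeneity fixes
only their number. -/
theorem sum_pair {x y z w : ℕ} {τ : Finset (Fin 20)}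
    (h : ∀ i, edge i ∈ tetraFaces x y z w ↔ i ∈ τ) (P : HomPartition)
    (G : Finset (Fin 20) → ℤ) :
    ∑ K ∈ pair P x y z w, G (firstPart K.1) =
      ∑ S ∈ τ.powersetCard (firstPart P.1 ∩ τ).card, G (firstPart P.1 \ τ ∪ S) := by
  have hcard : ∀ A : Finset (Fin 20), (A \ τ).card + (A ∩ τ).card = A.card := fun A =>
    Finset.card_sdiff_add_card_inter A τ
  refine Finset.sum_bij (fun K _ => firstPart K.1 ∩ τ) ?_ ?_ ?_ ?_
  · intro K hK
    rw [mem_pair_iff h] at hK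
    have h1 := hcard (firstPart K.1)
    have h2 := hcard (firstPart P.1)
    rw [card_firstPart] at h1 h2
    rw [hK] at h1
    exact Finset.mem_powersetCard.2 ⟨Finset.inter_subset_right, by omega⟩
  · intro K hK L hL hKL
    rw [mem_pair_iff h] at hK hL
    refine Subtype.ext (firstPart_injective ?_)
    rw [← Finset.sdiff_union_inter (firstPart K.1) τ, hKL, hK, ← hL, Finset.sdiff_union_inter]
  · intro S hS
    rw [Finset.mem_powersetCard] at hS
    have hd : Disjoint (firstPart P.1 \ τ) S := Finset.sdiff_disjoint.mono_right hS.1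
    obtain ⟨K, hK⟩ := exists_firstPart_eq (A := firstPart P.1 \ τ ∪ S) (by
      rw [Finset.card_union_of_disjoint hd, hS.2, hcard, card_firstPart])
    refine ⟨K, (mem_pair_iff h).2 ?_, ?_⟩
    · rw [hK, Finset.union_sdiff_distrib, Finset.sdiff_idem, Finset.sdiff_eq_empty_iff_subset.2 hS.1,
        Finset.union_empty]
    · rw [hK, Finset.union_inter_distrib_right, Finset.inter_eq_left.2 hS.1,
        Finset.disjoint_iff_inter_eq_empty.1 Finset.sdiff_disjoint, Finset.empty_union]
  · intro K hK
    rw [mem_pair_iff h] at hK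
    rw [← hK, Finset.sdiff_union_inter]

theorem firstPart_partitionOne : firstPart partitionOne = bits baseMask := by
  have key : ∀ i, tripleFinset i ∈ partitionOneEdges 0 ↔ i ∈ bits baseMask := by
    decide +kernel
  ext i
  rw [mem_firstPart, ← key]
  exact Finset.coe_injective.mem_set_image

/-- A relation with a nonzero term involves a set of size ten; the partition given by that set
yields exactly this relation. -/
theorem isSetSolution_of_sum_pair {G : Finset (Fin 20) → ℤ} (hG : ∀ A, A.card ≠ 10 → G A = 0)
    (h : ∀ (P : HomPartition) (x y z t : ℕ), 1 ≤ x → x < y → y < z → z < t → t ≤ 6 →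
      ∑ K ∈ pair P x y z t, G (firstPart K.1) = 0) : IsSetSolution G := by
  intro t ht j R hR
  by_contra hne
  obtain ⟨S, hS, hS0⟩ := Finset.exists_ne_zero_of_sum_ne_zero hne
  rw [Finset.mem_powersetCard] at hS
  obtain ⟨P, hP⟩ := exists_firstPart_eq (not_imp_comm.1 (hG _) hS0)
  obtain ⟨x, -, hx, y, -, hxy, z, -, hyz, w, hw, hzw, hf⟩ := exists_vertices t ht
  have hs := sum_pair (fun i => (edge_mem_tetraFaces i x y z w).trans (hf i)) P G
  rw [h P x y z w hx hxy hyz hzw (by omega), hP, Finset.union_sdiff_distrib,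
    Finset.sdiff_eq_self_of_disjoint hR, Finset.sdiff_eq_empty_iff_subset.2 hS.1,
    Finset.union_empty, Finset.union_inter_distrib_right, Finset.inter_eq_left.2 hS.1,
    Finset.disjoint_iff_inter_eq_empty.1 hR, Finset.empty_union, hS.2] at hs
  exact hne hs.symm

end TripleMask

theorem lemma4p8 :
    ∃! ε : HomPartition → ({-4, -1, 0, 1} : Set ℤ),
      (∀ (P : HomPartition) (x y z t : ℕ),
        1 ≤ x → x < y → y < z → z < t → t ≤ 6 →
          ∑ K ∈ pair P x y z t, (ε K : ℤ) = 0) ∧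
      (ε ⟨partitionOne, partitionOne_isHomogeneous⟩ : ℤ) = 1 := by
  obtain ⟨G, hG, hv, h1, huniq⟩ := TripleMask.exists_setSolution
  refine ⟨fun P => ⟨G (TripleMask.firstPart P.1), by simpa using hv _⟩, ⟨?_, ?_⟩, ?_⟩
  · intro P x y z w hx hxy hyz hzw hw
    obtain ⟨t, ht, hf⟩ := TripleMask.exists_tetra ⟨x, by omega⟩ ⟨y, by omega⟩ ⟨z, by omega⟩
      ⟨w, by omega⟩ ⟨hx, hxy, hyz, hzw⟩
    exact (TripleMask.sum_pair
      (fun i => (TripleMask.edge_mem_tetraFaces i x y z w).trans (hf i)) P G).trans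
      (hG t ht _ _ Finset.sdiff_disjoint)
  · exact (congrArg G TripleMask.firstPart_partitionOne).trans h1
  · rintro ε ⟨hε, hε1⟩
    classical
    -- Transport of `ε` to sets, extended by zero; the chosen partition is the only one, by
    -- `firstPart_injective`.
    let G' : Finset (Fin 20) → ℤ := fun A =>
      if h : A.card = 10 then ε (TripleMask.exists_firstPart_eq h).choose else 0
    have hG' : ∀ P : HomPartition, G' (TripleMask.firstPart P.1) = ε P := fun P => by
      have h := TripleMask.card_firstPart P
      have hc := (TripleMask.exists_firstPart_eq h).choose_spec
      have : (TripleMask.exists_firstPart_eq h).choose = P :=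
        Subtype.ext (TripleMask.firstPart_injective hc)
      simp only [G', dif_pos h, this]
    have hsol : TripleMask.IsSetSolution G' :=
      TripleMask.isSetSolution_of_sum_pair (fun A hA => dif_neg hA) fun P x y z t a b c d e => by
        simp only [hG']
        exact hε P x y z t a b c d e
    funext P
    refine Subtype.ext ?_
    rw [← hG']
    refine huniq G' hsol ?_ _ (TripleMask.card_firstPart P)
    rw [← TripleMask.firstPart_partitionOne]
    exact (hG' ⟨partitionOne, partitionOne_isHomogeneous⟩).trans hε1
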